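/- A (two-sided) restriction monoid is a monoid $S$ with two unary operations $^*$ and $^+$ satisfying, for all $x,y\in S$, $$xx^*=x,\quad x^*y^*=y^*x^*,\quad (xy^*)^*=x^*y^*,\quad x^*y=y(xy)^*,$$ $$x^+x=x,\quad x^+y^+=y^+x^+,\quad (x^+y)^+=x^+y^+,\quad xy^+=(xy)^+x,$$ $$(x^+)^*=x^+,\quad (x^*)^+=x^*.$$ It is called left ample if $ca=cb$ implies $c^*a=c^*b$ for all $a,b,c\in S$, right ample if $ac=bc$ implies $ac^+=bc^+$ for all $a,b,c\in S$, and ample if it is both left and right ample. Let $M$ be a monoid, let $M'=\{\lfloor m\rfloor : m\in M\}$ be a bijective copy of the set $M$, and let $\mathcal{FR}(M')$ be the free restriction monoid on the set $M'$. A set $R$ of relations $u=v$ with $u,v\in\mathcal{FR}(M')$ is called admissible if (1) the relations $\lfloor 1\rfloor=1$ and $\lfloor m\rfloor\lfloor n\rfloor=(\lfloor m\rfloor\lfloor n\rfloor)^+\lfloor mn\rfloor$ $(m,n\in M)$ belong to $R$ or, more generally, follow from $R$, and (2) every relation in $R$ follows from the relations $\lfloor 1\rfloor=1$ and $\lfloor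 m\rfloor\lfloor n\rfloor=\lfloor mn\rfloor$ $(m,n\in M)$. Here a relation $u=v$ follows from a set of relations if $(u,v)$ belongs to the congruence on $\mathcal{FR}(M')$ (with respect to the multiplication, $^*$ and $^+$) generated by that set. Let $\mathcal{FR}_R(M)$ denote the restriction monoid generated by $M'$ subject to the relations $R$, that is, the quotient of $\mathcal{FR}(M')$ by the congruence generated by $R$. **Theorem.** Let $M$ be a monoid and $R$ an admissible set of relations. Then 1. $M$ is left cancellative if and only if $\mathcal{FR}_R(M)$ is left ample; 2. $M$ is right cancellative if and only if $\mathcal{FR}_R(M)$ is right ample; 3. $M$ is (left and right) cancellative if and only if $\mathcal{FR}_R(M)$ is ample. -/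

import Mathlib

universe u

/-- A (two-sided) restriction monoid: a monoid with two unary operations `x ↦ x^*` (`rstar`) and
`x ↦ x^+` (`rplus`) satisfying the standard identities. -/
class RestrictionMonoid (S : Type u) extends Monoid S where
  /-- the operation `x ↦ x^*` -/
  rstar : S → S
  /-- the operation `x ↦ x^+` -/
  rplus : S → S
  mul_rstar_self : ∀ x : S, x * rstar x = x
  rstar_comm : ∀ x y : S, rstar x * rstar y = rstar y * rstar x
  rstar_mul_rstar : ∀ x y : S, rstar (x * rstar y) = rstar x * rstar y
  rstar_mul : ∀ x y : S, rstar x * y = y * rstar (x * y)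
  rplus_mul_self : ∀ x : S, rplus x * x = x
  rplus_comm : ∀ x y : S, rplus x * rplus y = rplus y * rplus x
  rplus_rplus_mul : ∀ x y : S, rplus (rplus x * y) = rplus x * rplus y
  mul_rplus : ∀ x y : S, x * rplus y = rplus (x * y) * x
  rstar_rplus : ∀ x : S, rstar (rplus x) = rplus x
  rplus_rstar : ∀ x : S, rplus (rstar x) = rstar x

namespace RestrictionMonoid

/-- Left ample: `ca = cb` implies `c^* a = c^* b`. -/
def IsLeftAmple (S : Type u) [RestrictionMonoid S] : Prop :=
  ∀ a b c : S, c * a = c * b → rstar c * a = rstar c * b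

/-- Right ample: `ac = bc` implies `a c^+ = b c^+`. -/
def IsRightAmple (S : Type u) [RestrictionMonoid S] : Prop :=
  ∀ a b c : S, a * c = b * c → a * rplus c = b * rplus c

/-- Ample: both left and right ample. -/
def IsAmple (S : Type u) [RestrictionMonoid S] : Prop :=
  IsRightAmple S ∧ IsLeftAmple S

/-- The congruence (for multiplication and both unary operations) on a restriction monoid generated
by a set `R` of pairs, a pair `(x, y)` being read as the relation `x = y`. `CongrGen R x y` says
that the relations `R` imply the relation `x = y`. -/
inductive CongrGen {S : Type u} [RestrictionMonoid S] (R : Set (S × S)) : S → S → Prop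
  | of (x y : S) : (x, y) ∈ R → CongrGen R x y
  | refl (x : S) : CongrGen R x x
  | symm {x y : S} : CongrGen R x y → CongrGen R y x
  | trans {x y z : S} : CongrGen R x y → CongrGen R y z → CongrGen R x z
  | mul {x x' y y' : S} : CongrGen R x x' → CongrGen R y y' → CongrGen R (x * y) (x' * y')
  | rstar {x x' : S} : CongrGen R x x' → CongrGen R (rstar x) (rstar x')
  | rplus {x x' : S} : CongrGen R x x' → CongrGen R (rplus x) (rplus x')

/-- The setoid of the congruence generated by `R`. -/
def congrSetoid {S : Type u} [RestrictionMonoid S] (R : Set (S × S)) : Setoid S where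
  r := CongrGen R
  iseqv := ⟨CongrGen.refl, CongrGen.symm, CongrGen.trans⟩

/-- The quotient of a restriction monoid by the congruence generated by `R`. -/
def PresentedQuotient {S : Type u} [RestrictionMonoid S] (R : Set (S × S)) : Type u :=
  Quotient (congrSetoid R)

instance PresentedQuotient.instRestrictionMonoid {S : Type u} [RestrictionMonoid S]
    (R : Set (S × S)) : RestrictionMonoid (PresentedQuotient R) where
  mul := Quotient.map₂ (· * ·) (fun _ _ h _ _ h' => CongrGen.mul h h')
  one := Quotient.mk (congrSetoid R) 1
  rstar := Quotient.map rstar (fun _ _ h => CongrGen.rstar h)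
  rplus := Quotient.map rplus (fun _ _ h => CongrGen.rplus h)
  mul_assoc := by
    rintro ⟨x⟩ ⟨y⟩ ⟨z⟩
    exact congrArg (Quotient.mk (congrSetoid R)) (mul_assoc x y z)
  one_mul := by
    rintro ⟨x⟩
    exact congrArg (Quotient.mk (congrSetoid R)) (one_mul x)
  mul_one := by
    rintro ⟨x⟩
    exact congrArg (Quotient.mk (congrSetoid R)) (mul_one x)
  mul_rstar_self := by
    rintro ⟨x⟩
    exact congrArg (Quotient.mk (congrSetoid R)) (mul_rstar_self x)
  rstar_comm := by
    rintro ⟨x⟩ ⟨y⟩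
    exact congrArg (Quotient.mk (congrSetoid R)) (rstar_comm x y)
  rstar_mul_rstar := by
    rintro ⟨x⟩ ⟨y⟩
    exact congrArg (Quotient.mk (congrSetoid R)) (rstar_mul_rstar x y)
  rstar_mul := by
    rintro ⟨x⟩ ⟨y⟩
    exact congrArg (Quotient.mk (congrSetoid R)) (rstar_mul x y)
  rplus_mul_self := by
    rintro ⟨x⟩
    exact congrArg (Quotient.mk (congrSetoid R)) (rplus_mul_self x)
  rplus_comm := by
    rintro ⟨x⟩ ⟨y⟩
    exact congrArg (Quotient.mk (congrSetoid R)) (rplus_comm x y)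
  rplus_rplus_mul := by
    rintro ⟨x⟩ ⟨y⟩
    exact congrArg (Quotient.mk (congrSetoid R)) (rplus_rplus_mul x y)
  mul_rplus := by
    rintro ⟨x⟩ ⟨y⟩
    exact congrArg (Quotient.mk (congrSetoid R)) (mul_rplus x y)
  rstar_rplus := by
    rintro ⟨x⟩
    exact congrArg (Quotient.mk (congrSetoid R)) (rstar_rplus x)
  rplus_rstar := by
    rintro ⟨x⟩
    exact congrArg (Quotient.mk (congrSetoid R)) (rplus_rstar x)

end RestrictionMonoid

/-- Terms in the signature of restriction monoids over a set `X` of generators. -/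
inductive RestrictionTerm (X : Type u) : Type u
  | of : X → RestrictionTerm X
  | one : RestrictionTerm X
  | mul : RestrictionTerm X → RestrictionTerm X → RestrictionTerm X
  | rstar : RestrictionTerm X → RestrictionTerm X
  | rplus : RestrictionTerm X → RestrictionTerm X

namespace RestrictionTerm

/-- The least congruence on terms that contains all instances of the axioms of restriction
monoids. -/
inductive Equal {X : Type u} : RestrictionTerm X → RestrictionTerm X → Prop
  | refl (x) : Equal x x
  | symm {x y} : Equal x y → Equal y x
  | trans {x y z} : Equal x y → Equal y z → Equal x z
  | mul_congr {x x' y y'} : Equal x x' → Equal y y' → Equal (mul x y) (mul x' y')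
  | rstar_congr {x x'} : Equal x x' → Equal (rstar x) (rstar x')
  | rplus_congr {x x'} : Equal x x' → Equal (rplus x) (rplus x')
  | mul_assoc (x y z) : Equal (mul (mul x y) z) (mul x (mul y z))
  | one_mul (x) : Equal (mul one x) x
  | mul_one (x) : Equal (mul x one) x
  | mul_rstar_self (x) : Equal (mul x (rstar x)) x
  | rstar_comm (x y) : Equal (mul (rstar x) (rstar y)) (mul (rstar y) (rstar x))
  | rstar_mul_rstar (x y) : Equal (rstar (mul x (rstar y))) (mul (rstar x) (rstar y))
  | rstar_mul (x y) : Equal (mul (rstar x) y) (mul y (rstar (mul x y)))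
  | rplus_mul_self (x) : Equal (mul (rplus x) x) x
  | rplus_comm (x y) : Equal (mul (rplus x) (rplus y)) (mul (rplus y) (rplus x))
  | rplus_rplus_mul (x y) : Equal (rplus (mul (rplus x) y)) (mul (rplus x) (rplus y))
  | mul_rplus (x y) : Equal (mul x (rplus y)) (mul (rplus (mul x y)) x)
  | rstar_rplus (x) : Equal (rstar (rplus x)) (rplus x)
  | rplus_rstar (x) : Equal (rplus (rstar x)) (rstar x)

/-- Terms up to the axioms of restriction monoids. -/
def setoid (X : Type u) : Setoid (RestrictionTerm X) where
  r := Equal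
  iseqv := ⟨Equal.refl, Equal.symm, Equal.trans⟩

end RestrictionTerm

/-- The free restriction monoid on the set `X` of generators. -/
def FreeRestrictionMonoid (X : Type u) : Type u :=
  Quotient (RestrictionTerm.setoid X)

namespace FreeRestrictionMonoid

open RestrictionTerm in
instance instRestrictionMonoid (X : Type u) : RestrictionMonoid (FreeRestrictionMonoid X) where
  mul := Quotient.map₂ mul (fun _ _ h _ _ h' => Equal.mul_congr h h')
  one := Quotient.mk (setoid X) one
  rstar := Quotient.map rstar (fun _ _ h => Equal.rstar_congr h)
  rplus := Quotient.map rplus (fun _ _ h => Equal.rplus_congr h)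
  mul_assoc := by
    rintro ⟨x⟩ ⟨y⟩ ⟨z⟩
    exact Quotient.sound (Equal.mul_assoc x y z)
  one_mul := by
    rintro ⟨x⟩
    exact Quotient.sound (Equal.one_mul x)
  mul_one := by
    rintro ⟨x⟩
    exact Quotient.sound (Equal.mul_one x)
  mul_rstar_self := by
    rintro ⟨x⟩
    exact Quotient.sound (Equal.mul_rstar_self x)
  rstar_comm := by
    rintro ⟨x⟩ ⟨y⟩
    exact Quotient.sound (Equal.rstar_comm x y)
  rstar_mul_rstar := by
    rintro ⟨x⟩ ⟨y⟩
    exact Quotient.sound (Equal.rstar_mul_rstar x y)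
  rstar_mul := by
    rintro ⟨x⟩ ⟨y⟩
    exact Quotient.sound (Equal.rstar_mul x y)
  rplus_mul_self := by
    rintro ⟨x⟩
    exact Quotient.sound (Equal.rplus_mul_self x)
  rplus_comm := by
    rintro ⟨x⟩ ⟨y⟩
    exact Quotient.sound (Equal.rplus_comm x y)
  rplus_rplus_mul := by
    rintro ⟨x⟩ ⟨y⟩
    exact Quotient.sound (Equal.rplus_rplus_mul x y)
  mul_rplus := by
    rintro ⟨x⟩ ⟨y⟩
    exact Quotient.sound (Equal.mul_rplus x y)
  rstar_rplus := by
    rintro ⟨x⟩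
    exact Quotient.sound (Equal.rstar_rplus x)
  rplus_rstar := by
    rintro ⟨x⟩
    exact Quotient.sound (Equal.rplus_rstar x)

/-- The generator `⌊x⌋` of the free restriction monoid. -/
def of {X : Type u} (x : X) : FreeRestrictionMonoid X :=
  Quotient.mk (RestrictionTerm.setoid X) (RestrictionTerm.of x)

end FreeRestrictionMonoid

open FreeRestrictionMonoid RestrictionMonoid in
/-- The relations `⌊1⌋ = 1` and `⌊m⌋⌊n⌋ = (⌊m⌋⌊n⌋)^+ ⌊mn⌋`, which say that `m ↦ ⌊m⌋` is a
premorphism. -/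
def premorphismRelations (M : Type u) [Monoid M] :
    Set (FreeRestrictionMonoid M × FreeRestrictionMonoid M) :=
  {p | p = (of 1, 1) ∨ ∃ m n : M, p = (of m * of n, rplus (of m * of n) * of (m * n))}

open FreeRestrictionMonoid in
/-- The relations `⌊1⌋ = 1` and `⌊m⌋⌊n⌋ = ⌊mn⌋`, which say that `m ↦ ⌊m⌋` is a homomorphism. -/
def homomorphismRelations (M : Type u) [Monoid M] :
    Set (FreeRestrictionMonoid M × FreeRestrictionMonoid M) :=
  {p | p = (of 1, 1) ∨ ∃ m n : M, p = (of m * of n, of (m * n))}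

open RestrictionMonoid in
/-- A set `R` of relations between elements of the free restriction monoid on (a copy of) the set
`M` is admissible if it contains, at least up to consequence, the premorphism relations, and is
implied by the homomorphism relations. -/
def IsAdmissible {M : Type u} [Monoid M]
    (R : Set (FreeRestrictionMonoid M × FreeRestrictionMonoid M)) : Prop :=
  (∀ x y, (x, y) ∈ premorphismRelations M → CongrGen R x y) ∧
    ∀ x y, (x, y) ∈ R → CongrGen (homomorphismRelations M) x y

/-- The expansion `FR_R(M)` of the monoid `M` with respect to the relations `R`: the restriction
monoid generated by (a copy of) the set `M` subject to the relations `R`. -/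
abbrev RestrictionExpansion {M : Type u} [Monoid M]
    (R : Set (FreeRestrictionMonoid M × FreeRestrictionMonoid M)) : Type u :=
  RestrictionMonoid.PresentedQuotient R

namespace RestrictionMonoid

/-! ### Identities in restriction monoids; premorphisms. -/

section Basic

variable {S : Type u} [RestrictionMonoid S]

/-! Let `M` carry trivial unary operations. The relations `R` hold there, so the expansion projects
onto `M`. Conversely `⌊·⌋` is a premorphism, so every `x` lies below the generator of its
projection: `x = x^+ ⌊proj x⌋` (`eq_rplus_mul_gen_proj`). Hence `x` is determined by `proj x`
together with either `x^+` or `x^*`. If `M` is left cancellative and `ca = cb`, then `c^*a` and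
`c^*b` have the same star, as `(c^*a)^* = (ca)^*`, and the same projection, by cancelling `proj c`;
so they coincide. If `cm = cn` in `M`, then `⌊c⌋⌊m⌋` and `⌊c⌋⌊n⌋` both lie below `⌊cm⌋` and become
equal after multiplication by a suitable projection; ampleness followed by projecting to `M` yields
`m = n`. The right-hand case is dual. -/

theorem rstar_rstar_mul (x y : S) : rstar (rstar x * y) = rstar (x * y) := by
  rw [rstar_mul, rstar_mul_rstar, rstar_comm, ← rstar_mul_rstar, mul_assoc, mul_rstar_self]

theorem rplus_mul_rplus (x y : S) : rplus (x * rplus y) = rplus (x * y) := by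
  rw [mul_rplus, rplus_rplus_mul, rplus_comm, ← rplus_rplus_mul, ← mul_assoc, rplus_mul_self]

end Basic

/-- A premorphism `g` from a monoid to a restriction monoid. -/
structure IsPremorphism {M S : Type u} [Monoid M] [RestrictionMonoid S] (g : M → S) : Prop where
  map_one : g 1 = 1
  map_mul : ∀ m n, g m * g n = rplus (g m * g n) * g (m * n)

namespace IsPremorphism

variable {M S : Type u} [Monoid M] [RestrictionMonoid S] {g : M → S}

/-- The premorphism condition is self-dual: moving the projection to the right of `g (m * n)` gives
the form needed for right ampleness. -/
theorem map_mul_rstar (hg : IsPremorphism g) (m n : M) :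
    g m * g n = g (m * n) * rstar (g m * g n) := by
  have h := rstar_mul (rplus (g m * g n)) (g (m * n))
  rwa [rstar_rplus, ← hg.map_mul] at h

/-- If `x ≤ g m` and `y ≤ g n` in the natural partial order, then `x * y ≤ g (m * n)`. -/
theorem eq_rplus_mul_mul (hg : IsPremorphism g) {x y : S} {m n : M}
    (hx : x = rplus x * g m) (hy : y = rplus y * g n) :
    x * y = rplus (x * y) * g (m * n) := by
  have key : x * y = rplus (rplus x * (rplus (g m * y) * (g m * g n))) * g (m * n) :=
    calc x * y = rplus x * (g m * rplus y) * g n := by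
          conv_lhs => rw [hx, hy]
          simp only [mul_assoc]
      _ = rplus x * (rplus (g m * y) * (g m * g n)) := by
          rw [mul_rplus]; simp only [mul_assoc]
      _ = _ := by
          conv_lhs => rw [hg.map_mul]
          rw [rplus_rplus_mul, rplus_rplus_mul]; simp only [mul_assoc]
  -- Any `z = p^+ a` satisfies `z^+ a = z`, because `(p^+ a)^+ = p^+ a^+` and `a^+ a = a`.
  have h2 : rplus (x * y) * g (m * n) = _ := congrArg (fun z => rplus z * g (m * n)) key
  rw [h2, rplus_rplus_mul, mul_assoc, rplus_mul_self, ← key]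

end IsPremorphism

end RestrictionMonoid

open RestrictionMonoid

/-- The natural order has a left and a right description; `rstar_mul` passes between them, since
`x^+` is its own star. -/
theorem RestrictionMonoid.eq_mul_rstar_of_eq_rplus_mul {S : Type u} [RestrictionMonoid S] {x a : S}
    (h : x = rplus x * a) : x = a * rstar x := by
  have h' := rstar_mul (rplus x) a
  rwa [rstar_rplus, ← h] at h'

/-! ### The projection onto `M`. -/

/-- The value of a term in the monoid `M`, where both unary operations are trivial. -/
def RestrictionTerm.eval {M : Type u} [Monoid M] : RestrictionTerm M → M
  | .of m => m
  | .one => 1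
  | .mul x y => x.eval * y.eval
  | .rstar _ => 1
  | .rplus _ => 1

/-- Any monoid with both unary operations constantly `1` satisfies the restriction axioms. -/
theorem RestrictionTerm.Equal.eval_eq {M : Type u} [Monoid M] {x y : RestrictionTerm M}
    (h : Equal x y) : x.eval = y.eval := by
  induction h <;> simp_all [RestrictionTerm.eval, _root_.mul_assoc]

/-- The canonical projection of the free restriction monoid on `M` onto `M`. -/
def FreeRestrictionMonoid.eval {M : Type u} [Monoid M] : FreeRestrictionMonoid M → M :=
  Quotient.lift RestrictionTerm.eval fun _ _ h => RestrictionTerm.Equal.eval_eq h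

namespace FreeRestrictionMonoid

variable {M : Type u} [Monoid M]

theorem eval_mul (x y : FreeRestrictionMonoid M) : eval (x * y) = eval x * eval y := by
  obtain ⟨x⟩ := x
  obtain ⟨y⟩ := y
  rfl

theorem eval_rstar (x : FreeRestrictionMonoid M) : eval (rstar x) = 1 := by
  obtain ⟨x⟩ := x
  rfl

theorem eval_rplus (x : FreeRestrictionMonoid M) : eval (rplus x) = 1 := by
  obtain ⟨x⟩ := x
  rfl

theorem eval_eq_of_congrGen {R : Set (FreeRestrictionMonoid M × FreeRestrictionMonoid M)}
    (hR : ∀ x y, (x, y) ∈ R → eval x = eval y) {x y : FreeRestrictionMonoid M}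
    (h : CongrGen R x y) : eval x = eval y := by
  induction h with
  | of x y h => exact hR x y h
  | refl => rfl
  | symm _ ih => exact ih.symm
  | trans _ _ ih ih' => exact ih.trans ih'
  | mul _ _ ih ih' => rw [eval_mul, eval_mul, ih, ih']
  | rstar => rw [eval_rstar, eval_rstar]
  | rplus => rw [eval_rplus, eval_rplus]

theorem eval_eq_of_mem_homomorphismRelations (x y : FreeRestrictionMonoid M)
    (h : (x, y) ∈ homomorphismRelations M) : eval x = eval y := by
  rcases h with h | ⟨m, n, h⟩ <;> obtain ⟨rfl, rfl⟩ := Prod.mk.inj h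
  · rfl
  · rfl

end FreeRestrictionMonoid

/-! ### Properness of the expansion, and ampleness. -/

namespace IsAdmissible

variable {M : Type u} [Monoid M] {R : Set (FreeRestrictionMonoid M × FreeRestrictionMonoid M)}

/-- The canonical projection of `FR_R(M)` onto `M`. -/
def proj (hR : IsAdmissible R) : RestrictionExpansion R → M :=
  Quotient.lift FreeRestrictionMonoid.eval fun _ _ h =>
    FreeRestrictionMonoid.eval_eq_of_congrGen
      -- `R` follows from the homomorphism relations, which hold in `M`.
      (fun x y hxy => FreeRestrictionMonoid.eval_eq_of_congrGen
        FreeRestrictionMonoid.eval_eq_of_mem_homomorphismRelations (hR.2 x y hxy)) h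

theorem proj_mul (hR : IsAdmissible R) (x y : RestrictionExpansion R) :
    hR.proj (x * y) = hR.proj x * hR.proj y := by
  obtain ⟨x⟩ := x
  obtain ⟨y⟩ := y
  exact FreeRestrictionMonoid.eval_mul x y

theorem proj_rstar (hR : IsAdmissible R) (x : RestrictionExpansion R) :
    hR.proj (rstar x) = 1 := by
  obtain ⟨x⟩ := x
  exact FreeRestrictionMonoid.eval_rstar x

theorem proj_rplus (hR : IsAdmissible R) (x : RestrictionExpansion R) :
    hR.proj (rplus x) = 1 := by
  obtain ⟨x⟩ := x
  exact FreeRestrictionMonoid.eval_rplus x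

/-- The generator `⌊m⌋` of `FR_R(M)`. -/
def gen (_ : IsAdmissible R) (m : M) : RestrictionExpansion R :=
  Quotient.mk (congrSetoid R) (FreeRestrictionMonoid.of m)

theorem proj_gen (hR : IsAdmissible R) (m : M) : hR.proj (hR.gen m) = m := rfl

theorem isPremorphism_gen (hR : IsAdmissible R) : IsPremorphism hR.gen where
  map_one := Quotient.sound (hR.1 _ _ (Or.inl rfl))
  map_mul m n := Quotient.sound (hR.1 _ _ (Or.inr ⟨m, n, rfl⟩))

/-- Being below a generator is inherited by products (`eq_rplus_mul_mul`), and starred or plussed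
elements are projections, hence below `1 = ⌊1⌋`. -/
theorem eq_rplus_mul_gen_proj (hR : IsAdmissible R) (x : RestrictionExpansion R) :
    x = rplus x * hR.gen (hR.proj x) := by
  have hg := hR.isPremorphism_gen
  obtain ⟨⟨t⟩⟩ := x
  induction t with
  | of m => exact (rplus_mul_self (hR.gen m)).symm
  | one =>
    change (1 : RestrictionExpansion R) = rplus 1 * hR.gen 1
    rw [hg.map_one, rplus_mul_self]
  | mul s t ihs iht => exact hg.eq_rplus_mul_mul ihs iht
  | rstar t =>
    let y : RestrictionExpansion R :=
      Quotient.mk (congrSetoid R) (Quotient.mk (RestrictionTerm.setoid M) t)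
    change rstar y = rplus (rstar y) * hR.gen 1
    rw [hg.map_one, mul_one, rplus_rstar]
  | rplus t =>
    let y : RestrictionExpansion R :=
      Quotient.mk (congrSetoid R) (Quotient.mk (RestrictionTerm.setoid M) t)
    change rplus y = rplus (rplus y) * hR.gen 1
    rw [hg.map_one, mul_one, ← rstar_rplus y, rplus_rstar]

/-- `FR_R(M)` is proper: an element is determined by its projection to `M` and its `^+`. -/
theorem eq_of_rplus_eq (hR : IsAdmissible R) {x y : RestrictionExpansion R}
    (h : rplus x = rplus y) (hp : hR.proj x = hR.proj y) : x = y := by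
  rw [hR.eq_rplus_mul_gen_proj x, hR.eq_rplus_mul_gen_proj y, h, hp]

/-- `FR_R(M)` is proper: an element is determined by its projection to `M` and its `^*`. -/
theorem eq_of_rstar_eq (hR : IsAdmissible R) {x y : RestrictionExpansion R}
    (h : rstar x = rstar y) (hp : hR.proj x = hR.proj y) : x = y := by
  rw [eq_mul_rstar_of_eq_rplus_mul (hR.eq_rplus_mul_gen_proj x),
    eq_mul_rstar_of_eq_rplus_mul (hR.eq_rplus_mul_gen_proj y), h, hp]

theorem isLeftCancelMul_iff_isLeftAmple (hR : IsAdmissible R) :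
    IsLeftCancelMul M ↔ IsLeftAmple (RestrictionExpansion R) := by
  constructor
  · intro _ a b c h
    refine hR.eq_of_rstar_eq ?_ ?_
    · rw [rstar_rstar_mul, rstar_rstar_mul, h]
    · have hp := congrArg hR.proj h
      rw [hR.proj_mul, hR.proj_mul] at hp
      rw [hR.proj_mul, hR.proj_mul, mul_left_cancel hp]
  · refine fun hS => ⟨fun c m n h => ?_⟩
    have hg := hR.isPremorphism_gen
    set e := rplus (hR.gen c * hR.gen m)
    set f := rplus (hR.gen c * hR.gen n) with hf
    have hef : e * f = f * e := rplus_comm _ _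
    have hm : e * (hR.gen c * hR.gen m) = hR.gen c * hR.gen m := rplus_mul_self _
    have hn : f * (hR.gen c * hR.gen n) = hR.gen c * hR.gen n := rplus_mul_self _
    -- The two products are `e⌊cm⌋` and `f⌊cn⌋` with `cm = cn`; multiplying each by the other's
    -- projection equalizes them.
    have key : f * e * hR.gen c * hR.gen m = f * e * hR.gen c * hR.gen n := by
      calc f * e * hR.gen c * hR.gen m = f * (e * (hR.gen c * hR.gen m)) := by
            simp only [mul_assoc]
        _ = f * (e * hR.gen (c * m)) := by rw [hm, hg.map_mul]
        _ = e * (f * hR.gen (c * n)) := by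
            rw [← mul_assoc, ← hef, mul_assoc, show c * m = c * n from h]
        _ = e * (f * (hR.gen c * hR.gen n)) := by rw [hn, hf, ← hg.map_mul]
        _ = f * e * hR.gen c * hR.gen n := by rw [← hef]; simp only [mul_assoc]
    -- Ampleness replaces the left factor `f * e * hR.gen c` by its star, which projects to `1`.
    have hp := congrArg hR.proj (hS _ _ _ key)
    simpa only [hR.proj_mul, hR.proj_rstar, hR.proj_gen, one_mul] using hp

theorem isRightCancelMul_iff_isRightAmple (hR : IsAdmissible R) :
    IsRightCancelMul M ↔ IsRightAmple (RestrictionExpansion R) := by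
  constructor
  · intro _ a b c h
    refine hR.eq_of_rplus_eq ?_ ?_
    · rw [rplus_mul_rplus, rplus_mul_rplus, h]
    · have hp := congrArg hR.proj h
      rw [hR.proj_mul, hR.proj_mul] at hp
      rw [hR.proj_mul, hR.proj_mul, mul_right_cancel hp]
  · refine fun hS => ⟨fun c m n h => ?_⟩
    have hg := hR.isPremorphism_gen
    set e := rstar (hR.gen m * hR.gen c)
    set f := rstar (hR.gen n * hR.gen c) with hf
    have hef : e * f = f * e := rstar_comm _ _
    have hm : hR.gen m * hR.gen c * e = hR.gen m * hR.gen c := mul_rstar_self _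
    have hn : hR.gen n * hR.gen c * f = hR.gen n * hR.gen c := mul_rstar_self _
    -- Here the projections act on the right, so that `⌊c⌋ef` is the factor to be cancelled.
    have key : hR.gen m * (hR.gen c * (e * f)) = hR.gen n * (hR.gen c * (e * f)) := by
      calc hR.gen m * (hR.gen c * (e * f)) = hR.gen m * hR.gen c * e * f := by
            simp only [mul_assoc]
        _ = hR.gen (m * c) * e * f := by rw [hm, hg.map_mul_rstar]
        _ = hR.gen (n * c) * f * e := by
            rw [mul_assoc, hef, ← mul_assoc, show m * c = n * c from h]
        _ = hR.gen n * hR.gen c * f * e := by rw [hn, hf, ← hg.map_mul_rstar]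
        _ = hR.gen n * (hR.gen c * (e * f)) := by rw [hef]; simp only [mul_assoc]
    have hp := congrArg hR.proj (hS _ _ _ key)
    simpa only [hR.proj_mul, hR.proj_rplus, hR.proj_gen, mul_one] using hp

end IsAdmissible

theorem mainTheorem3 {M : Type u} [Monoid M]
    (R : Set (FreeRestrictionMonoid M × FreeRestrictionMonoid M)) (hR : IsAdmissible R) :
    (IsLeftCancelMul M ↔ RestrictionMonoid.IsLeftAmple (RestrictionExpansion R)) ∧
    (IsRightCancelMul M ↔ RestrictionMonoid.IsRightAmple (RestrictionExpansion R)) ∧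
    (IsCancelMul M ↔ RestrictionMonoid.IsAmple (RestrictionExpansion R)) := by
  have hl := hR.isLeftCancelMul_iff_isLeftAmple
  have hr := hR.isRightCancelMul_iff_isRightAmple
  refine ⟨hl, hr, fun h => ⟨hr.1 inferInstance, hl.1 inferInstance⟩, fun h => ?_⟩
  have := hl.2 h.2
  have := hr.2 h.1
  exact {}
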